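/- For $n\in\mathbf N=\{0,1,2,\dots\}$ let $P(n)$ be the symmetric Pascal matrix, the $n\times n$ integer matrix with entries $p_{i,j}=\binom{i+j}{i}$, $0\le i,j<n$, and let $\chi_n(t)=\det(tI-P(n))\in\mathbf Z[t]$ be its characteristic polynomial. There is a unique sequence of integers $\gamma(0),\gamma(1),\gamma(2),\dots$ with $\gamma(0)=0$ and $$\gamma(2^l-k)=\frac{2^l+2(-1)^l}{3}-k+2\gamma(k)\qquad\text{for all integers } l\ge 0 \text{ and } 0\le k\le 2^{l-1}.$$ Moreover, for every $n\in\mathbf N$, the numbers $\gamma(n)$ and $\gamma_2(n)=\tfrac12(n-\gamma(n))$ are non-negative integers, $$\chi_n(t)\equiv (t+1)^{\gamma(n)}\,(t^2+t+1)^{\gamma_2(n)}\pmod 2,$$ and the matrix $I-P(n)^3$ is nilpotent over $\mathbf F_2$. -/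

import Mathlib

/-- The symmetric Pascal matrix of order `n`, with entries `(i + j).choose i` for `0 ≤ i, j < n`. -/
def symPascal (n : ℕ) : Matrix (Fin n) (Fin n) ℤ :=
  Matrix.of fun i j => (((i : ℕ) + (j : ℕ)).choose (i : ℕ) : ℤ)

/-- The characteristic polynomial `χ_n(t) = det (t I - P(n))`, over the integers. -/
noncomputable def symPascalChi (n : ℕ) : Polynomial ℤ := (symPascal n).charpoly

theorem two_pow_clog_sub_lt (m : ℕ) : 2 ^ Nat.clog 2 (m + 1) - (m + 1) < m + 1 := by
  rcases Nat.eq_zero_or_pos m with rfl | hm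
  · simp
  · have h1 : 2 ^ (Nat.clog 2 (m + 1)).pred < m + 1 :=
      Nat.pow_pred_clog_lt_self (by norm_num) (by omega)
    have h2 : 0 < Nat.clog 2 (m + 1) := Nat.clog_pos (by norm_num) (by omega)
    obtain ⟨l, hl⟩ : ∃ l, Nat.clog 2 (m + 1) = l + 1 := ⟨_, (Nat.succ_pred_eq_of_pos h2).symm⟩
    rw [hl] at h1 ⊢
    simp only [Nat.pred_eq_sub_one, Nat.add_sub_cancel] at h1
    rw [pow_succ]
    omega

/-- The sequence `γ`, with `γ(0) = 0` and, for `n ≥ 1`,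
`γ(n) = (2^l + 2 (-1)^l) / 3 - k + 2 γ(k)`, where `2^l` is the least power of `2` with `n ≤ 2^l`
and `k = 2^l - n`. (The division by `3` is exact, and `k ≤ 2^l / 2`.) -/
def pascalGamma : ℕ → ℤ
  | 0 => 0
  | m + 1 =>
    ((2 : ℤ) ^ Nat.clog 2 (m + 1) + 2 * (-1) ^ Nat.clog 2 (m + 1)) / 3
      - ((2 ^ Nat.clog 2 (m + 1) - (m + 1) : ℕ) : ℤ)
      + 2 * pascalGamma (2 ^ Nat.clog 2 (m + 1) - (m + 1))
  termination_by n => n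
  decreasing_by exact two_pow_clog_sub_lt m

/-- `δ` satisfies the recursion that determines `γ`: `δ(0) = 0` and
`δ(2^l - k) = (2^l + 2 (-1)^l) / 3 - k + 2 δ(k)` for all `l` and all `0 ≤ k ≤ 2^l / 2`. -/
def IsPascalGamma (δ : ℕ → ℤ) : Prop :=
  δ 0 = 0 ∧
    ∀ l k : ℕ, 2 * k ≤ 2 ^ l →
      (δ (2 ^ l - k) : ℚ) = ((2 : ℚ) ^ l + 2 * (-1) ^ l) / 3 - (k : ℚ) + 2 * (δ k : ℚ)

/-- The sequence `γ₂(n) = (n - γ(n)) / 2`; that the division is exact is part of the theorem. -/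
def pascalGammaTwo (n : ℕ) : ℤ := ((n : ℤ) - pascalGamma n) / 2

/-! Work over F₂. By Lucas, the Pascal matrix of order 2^l is a Kronecker power of T =
[[1,1],[1,0]]; hence its square is its reversal and its cube is 1. For n + k = 2^l with k ≤ n it has
upper left block P(n) and lower right block 0, and the lower right block of its square is the
reversal of P(k). A block determinant (`charpoly_fromBlocks_mul_det`) then gives χ_{2^l} χ_k² = χ_n
(X³ - 1)^k. The case n = k determines χ_{2^l} inductively; in general, comparing exponents of the
coprime factors X + 1 and X² + X + 1 reproduces the recursion for γ. -/

/-! ### Block matrices of cube one -/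

open Polynomial in
/-- If `M` is a block matrix with vanishing lower right block and `M ^ 3 = 1`, its characteristic
polynomial is related to that of its upper left block. -/
theorem charpoly_fromBlocks_mul_det {R m k : Type*} [CommRing R] [Fintype m] [Fintype k]
    [DecidableEq m] [DecidableEq k] (A : Matrix m m R) (B : Matrix m k R) (C : Matrix k m R)
    (h : Matrix.fromBlocks A B C 0 ^ 3 = 1) :
    (Matrix.fromBlocks A B C 0).charpoly * ((X ^ 2 : R[X]) • 1 + (C * B).map Polynomial.C).det =
      A.charpoly * (X ^ 3 - 1) ^ Fintype.card k := by
  rw [pow_three', Matrix.fromBlocks_multiply, Matrix.fromBlocks_multiply,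
    ← Matrix.fromBlocks_one, Matrix.fromBlocks_inj] at h
  obtain ⟨-, h12, -, h22⟩ := h
  simp only [Matrix.mul_zero, add_zero] at h12 h22
  have h12' := congrArg (fun N => N.map Polynomial.C) h12
  have h22' := congrArg (fun N => N.map Polynomial.C) h22
  simp only [Matrix.add_mul, Matrix.zero_mul, add_zero,
    Matrix.map_add _ fun _ _ => Polynomial.C_add, Matrix.map_mul] at h12' h22'
  rw [Matrix.map_zero _ Polynomial.C_0] at h12'
  rw [Matrix.map_one _ Polynomial.C_0 Polynomial.C_1] at h22'
  set A' := A.map Polynomial.C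
  set B' := B.map Polynomial.C
  set C' := C.map Polynomial.C
  have hA : A.charmatrix = (X : R[X]) • 1 - A' := by
    rw [Matrix.charmatrix, Matrix.scalar_apply, Matrix.smul_one_eq_diagonal]; rfl
  have h0 : (0 : Matrix k k R).charmatrix = (X : R[X]) • 1 := by
    rw [Matrix.charmatrix_zero, Matrix.scalar_apply, Matrix.smul_one_eq_diagonal]
  -- With N the block matrix, (X - N)(X² + XN + N²) = X³ - 1. The multiplier keeps the second block
  -- column of X² + XN + N² and replaces the first by that of the identity.
  have key : (Matrix.fromBlocks A B C 0).charmatrix *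
      Matrix.fromBlocks 1 ((X : R[X]) • B' + A' * B') 0 ((X ^ 2 : R[X]) • 1 + C' * B') =
      Matrix.fromBlocks A.charmatrix 0 (-C') ((X ^ 3 - 1 : R[X]) • 1) := by
    rw [Matrix.charmatrix_fromBlocks, Matrix.fromBlocks_multiply, Matrix.fromBlocks_inj]
    refine ⟨by simp, ?_, by simp [C'], ?_⟩
    · rw [hA]
      change _ * _ + -B' * _ = 0
      have : A' * (A' * B') = - (B' * (C' * B')) := by
        rw [eq_neg_iff_add_eq_zero, ← Matrix.mul_assoc, ← Matrix.mul_assoc, h12']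
      simp only [Matrix.sub_mul, Matrix.mul_add, Matrix.smul_mul, Matrix.one_mul, Matrix.mul_smul,
        Matrix.neg_mul, Matrix.mul_one, this, smul_sub, smul_neg, smul_smul, ← pow_two]
      abel
    · rw [h0]
      change -C' * ((X : R[X]) • B' + A' * B') +
        ((X : R[X]) • (1 : Matrix k k R[X])) * ((X ^ 2 : R[X]) • 1 + C' * B') = _
      have : C' * (A' * B') = 1 := by rw [← Matrix.mul_assoc, h22']
      simp only [Matrix.mul_add, Matrix.smul_mul, Matrix.one_mul, Matrix.mul_smul,
        Matrix.neg_mul, this, smul_smul, sub_smul, one_smul, smul_neg, ← pow_succ]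
      abel
  have hdet := congrArg Matrix.det key
  rw [Matrix.det_mul, Matrix.det_fromBlocks_zero₂₁, Matrix.det_one, one_mul,
    Matrix.det_fromBlocks_zero₁₂, Matrix.det_smul, Matrix.det_one, mul_one] at hdet
  rw [Matrix.map_mul]
  exact hdet

/-- `det (X ^ 2 + M) = χ_M ^ 2` over the field with two elements. -/
theorem det_X_sq_add_map_C {k : Type*} [Fintype k] [DecidableEq k] (M : Matrix k k (ZMod 2)) :
    ((Polynomial.X ^ 2 : Polynomial (ZMod 2)) • 1 + M.map Polynomial.C).det = M.charpoly ^ 2 := by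
  -- Frobenius: f(X)² = f(X²) over F₂.
  rw [← ZMod.expand_card M.charpoly, Matrix.charpoly, AlgHom.map_det]
  congr 1
  ext1 i j
  rw [AlgHom.mapMatrix_apply, Matrix.map_apply, Matrix.charmatrix_apply]
  by_cases hij : i = j
  · subst hij
    simp [CharTwo.sub_eq_add]
  · simp [hij, CharTwo.neg_eq]

/-! ### Binomial coefficients modulo 2 and binary digits -/

/-- The binomial coefficient `(i + j).choose i` modulo `2`. -/
def pascalModTwo (i j : ℕ) : ZMod 2 := ((i + j).choose i : ℕ)

/-- Lucas for the last binary digit: this is the Kronecker factor T, which reduces the identities of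
order 2^l to T² = reversal of T and T³ = 1. -/
theorem pascalModTwo_bit (i j a b : ℕ) (ha : a < 2) (hb : b < 2) :
    pascalModTwo (2 * i + a) (2 * j + b) =
      if a = 1 ∧ b = 1 then 0 else pascalModTwo i j := by
  have : Fact (Nat.Prime 2) := ⟨Nat.prime_two⟩
  unfold pascalModTwo
  have h := (ZMod.natCast_eq_natCast_iff _ _ _).2
    (Choose.choose_modEq_choose_mod_mul_choose_div_nat
      (n := 2 * i + a + (2 * j + b)) (k := 2 * i + a) (p := 2))
  rw [h]
  have hi : (2 * i + a) / 2 = i := by omega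
  have hi' : (2 * i + a) % 2 = a := by omega
  rw [hi, hi']
  interval_cases a <;> interval_cases b
  · rw [show (2 * i + 0 + (2 * j + 0)) / 2 = i + j by omega]; simp
  · rw [show (2 * i + 0 + (2 * j + 1)) / 2 = i + j by omega]; simp
  · rw [show (2 * i + 1 + (2 * j + 0)) / 2 = i + j by omega,
      show (2 * i + 1 + (2 * j + 0)) % 2 = 1 by omega]; simp
  · rw [show (2 * i + 1 + (2 * j + 1)) % 2 = 0 by omega]; simp

theorem sum_range_two_mul {M : Type*} [AddCommMonoid M] (f : ℕ → M) (n : ℕ) :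
    ∑ j ∈ Finset.range (2 * n), f j = ∑ j ∈ Finset.range n, (f (2 * j + 0) + f (2 * j + 1)) := by
  induction n with
  | zero => simp
  | succ n ih =>
    rw [mul_add, mul_one, Finset.sum_range_succ, Finset.sum_range_succ, ih,
      Finset.sum_range_succ, add_assoc, add_zero]

theorem exists_two_mul_add {n q : ℕ} (h : n < 2 * q) : ∃ i a, n = 2 * i + a ∧ a < 2 ∧ i < q :=
  ⟨n / 2, n % 2, by omega, by omega, by omega⟩

/-- The sum overflows l bits only if some position has both digits 1, and that position contributes
a factor 0. -/
theorem pascalModTwo_eq_zero (l : ℕ) : ∀ i j, i < 2 ^ l → j < 2 ^ l → 2 ^ l ≤ i + j →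
    pascalModTwo i j = 0 := by
  induction l with
  | zero => intro i j hi hj h; omega
  | succ l ih =>
    intro i j hi hj h
    rw [pow_succ'] at hi hj h
    obtain ⟨i, a, rfl, ha, hi'⟩ := exists_two_mul_add hi
    obtain ⟨j, b, rfl, hb, hj'⟩ := exists_two_mul_add hj
    rw [pascalModTwo_bit i j a b ha hb]
    split_ifs with hab
    · rfl
    · exact ih i j hi' hj' (by omega)

/-- The square of the Pascal matrix of order `2 ^ l` is its reversal. -/
theorem sum_pascalModTwo_mul (l : ℕ) : ∀ i k, i < 2 ^ l → k < 2 ^ l →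
    ∑ j ∈ Finset.range (2 ^ l), pascalModTwo i j * pascalModTwo j k =
      pascalModTwo (2 ^ l - 1 - i) (2 ^ l - 1 - k) := by
  induction l with
  | zero =>
    intro i k hi hk
    obtain rfl : i = 0 := by omega
    obtain rfl : k = 0 := by omega
    simp [pascalModTwo]
  | succ l ih =>
    intro i k hi hk
    rw [pow_succ'] at hi hk ⊢
    obtain ⟨i, a, rfl, ha, hi'⟩ := exists_two_mul_add hi
    obtain ⟨k, b, rfl, hb, hk'⟩ := exists_two_mul_add hk
    rw [sum_range_two_mul,
      show 2 * 2 ^ l - 1 - (2 * i + a) = 2 * (2 ^ l - 1 - i) + (1 - a) by omega,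
      show 2 * 2 ^ l - 1 - (2 * k + b) = 2 * (2 ^ l - 1 - k) + (1 - b) by omega,
      pascalModTwo_bit _ _ (1 - a) (1 - b) (by omega) (by omega), ← ih i k hi' hk']
    simp only [pascalModTwo_bit _ _ _ _ ha (Nat.zero_lt_two), pascalModTwo_bit _ _ _ _ ha
      Nat.one_lt_two, pascalModTwo_bit _ _ _ _ Nat.zero_lt_two hb,
      pascalModTwo_bit _ _ _ _ Nat.one_lt_two hb]
    interval_cases a <;> interval_cases b <;> simp [CharTwo.add_self_eq_zero]

/-- The reversal of the Pascal matrix of order `2 ^ l` is its inverse. -/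
theorem sum_pascalModTwo_mul_rev (l : ℕ) : ∀ i k, i < 2 ^ l → k < 2 ^ l →
    ∑ j ∈ Finset.range (2 ^ l),
      pascalModTwo (2 ^ l - 1 - i) (2 ^ l - 1 - j) * pascalModTwo j k =
      if i = k then 1 else 0 := by
  induction l with
  | zero =>
    intro i k hi hk
    obtain rfl : i = 0 := by omega
    obtain rfl : k = 0 := by omega
    simp [pascalModTwo]
  | succ l ih =>
    intro i k hi hk
    rw [pow_succ'] at hi hk ⊢
    obtain ⟨i, a, rfl, ha, hi'⟩ := exists_two_mul_add hi
    obtain ⟨k, b, rfl, hb, hk'⟩ := exists_two_mul_add hk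
    have e : ∀ j c, j < 2 ^ l → c < 2 →
        2 * 2 ^ l - 1 - (2 * j + c) = 2 * (2 ^ l - 1 - j) + (1 - c) := by
      intro j c hj hc; omega
    have hik : (2 * i + a = 2 * k + b) ↔ (i = k ∧ a = b) := by omega
    have h1 : 1 - a < 2 := by omega
    rw [sum_range_two_mul, Finset.sum_congr rfl fun j hj => by
      rw [e i a hi' ha, e j 0 (Finset.mem_range.1 hj) Nat.zero_lt_two,
        e j 1 (Finset.mem_range.1 hj) Nat.one_lt_two]]
    simp only [hik, pascalModTwo_bit _ _ _ _ h1 (show 1 - 0 < 2 by omega), pascalModTwo_bit _ _ _ _ h1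
      (show 1 - 1 < 2 by omega), pascalModTwo_bit _ _ _ _ Nat.zero_lt_two hb,
      pascalModTwo_bit _ _ _ _ Nat.one_lt_two hb]
    have := ih i k hi' hk'
    interval_cases a <;> interval_cases b <;> simp [CharTwo.add_self_eq_zero, this]

/-! ### Matrices of order 2^l and the relation between characteristic polynomials -/

/-- The symmetric Pascal matrix modulo `2`. -/
def symPascalModTwo (n : ℕ) : Matrix (Fin n) (Fin n) (ZMod 2) :=
  Matrix.of fun i j => pascalModTwo i j

theorem symPascal_map (n : ℕ) :
    (symPascal n).map (Int.castRingHom (ZMod 2)) = symPascalModTwo n := by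
  ext i j
  simp [symPascal, symPascalModTwo, pascalModTwo]

theorem symPascalModTwo_sq_apply (l n : ℕ) (hn : n = 2 ^ l) (i j : Fin n) :
    (symPascalModTwo n * symPascalModTwo n) i j = pascalModTwo (n - 1 - i) (n - 1 - j) := by
  subst hn
  rw [← sum_pascalModTwo_mul l i j i.2 j.2, Matrix.mul_apply,
    ← Fin.sum_univ_eq_sum_range (fun x => pascalModTwo i x * pascalModTwo x j)]
  rfl

theorem symPascalModTwo_pow_three (l n : ℕ) (hn : n = 2 ^ l) : symPascalModTwo n ^ 3 = 1 := by
  ext i j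
  rw [pow_three', Matrix.mul_apply]
  simp only [symPascalModTwo_sq_apply l n hn]
  subst hn
  simp only [Matrix.one_apply, Fin.ext_iff]
  rw [← sum_pascalModTwo_mul_rev l i j i.2 j.2, ← Fin.sum_univ_eq_sum_range
    (fun x => pascalModTwo (2 ^ l - 1 - i) (2 ^ l - 1 - x) * pascalModTwo x j)]
  rfl

/-- The relation between the characteristic polynomials of orders `2 ^ l`, `2 ^ l - k` and `k`. -/
theorem charpoly_symPascalModTwo_mul (l m k : ℕ) (h : m + k = 2 ^ l) (hk : k ≤ m) :
    (symPascalModTwo (m + k)).charpoly * (symPascalModTwo k).charpoly ^ 2 =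
      (symPascalModTwo m).charpoly * (Polynomial.X ^ 3 - 1) ^ k := by
  set N := Matrix.reindex finSumFinEquiv.symm finSumFinEquiv.symm (symPascalModTwo (m + k)) with hN
  have hcN : N.charpoly = (symPascalModTwo (m + k)).charpoly := Matrix.charpoly_reindex _ _
  have h11 : N.toBlocks₁₁ = symPascalModTwo m := by
    ext i j
    simp [hN, Matrix.toBlocks₁₁, symPascalModTwo]
  have h22 : N.toBlocks₂₂ = 0 := by
    ext i j
    simp only [hN, Matrix.toBlocks₂₂, symPascalModTwo, Matrix.of_apply, Matrix.reindex_apply,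
      Matrix.submatrix_apply, Equiv.symm_symm, finSumFinEquiv_apply_right, Fin.val_natAdd,
      Matrix.zero_apply]
    -- Both indices are at least m, and 2m ≥ m + k = 2^l.
    exact pascalModTwo_eq_zero l _ _ (by omega) (by omega) (by omega)
  have hblock : N = Matrix.fromBlocks (symPascalModTwo m) N.toBlocks₁₂ N.toBlocks₂₁ 0 := by
    rw [← h11, ← h22, Matrix.fromBlocks_toBlocks]
  have hpow : N ^ 3 = 1 := by
    have := symPascalModTwo_pow_three l _ h
    rw [hN, ← Matrix.coe_reindexAlgEquiv (ZMod 2) (ZMod 2), ← map_pow, this, map_one]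
  have hsq : N * N = Matrix.reindex finSumFinEquiv.symm finSumFinEquiv.symm
      (symPascalModTwo (m + k) * symPascalModTwo (m + k)) := by
    rw [hN, ← Matrix.coe_reindexAlgEquiv (ZMod 2) (ZMod 2), map_mul]
  have hCB : N.toBlocks₂₁ * N.toBlocks₁₂ =
      Matrix.reindex Fin.revPerm Fin.revPerm (symPascalModTwo k) := by
    have h1 := congrArg Matrix.toBlocks₂₂ hsq
    rw [hblock, Matrix.fromBlocks_multiply, Matrix.toBlocks_fromBlocks₂₂, mul_zero, add_zero] at h1
    rw [h1]
    ext i j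
    simp only [Matrix.toBlocks₂₂, Matrix.of_apply, Matrix.reindex_apply,
      Matrix.submatrix_apply, Equiv.symm_symm, finSumFinEquiv_apply_right,
      symPascalModTwo_sq_apply l _ h, Fin.val_natAdd, Fin.revPerm_symm, Fin.revPerm_apply]
    simp only [symPascalModTwo, Matrix.of_apply, Fin.val_rev]
    congr 1 <;> omega
  have key := charpoly_fromBlocks_mul_det (symPascalModTwo m) N.toBlocks₁₂ N.toBlocks₂₁
    (by rw [← hblock]; exact hpow)
  rw [← hblock, hcN, det_X_sq_add_map_C, hCB, Matrix.charpoly_reindex, Fintype.card_fin] at key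
  exact key

/-! ### The factors of X³ - 1 and their exponents -/

open Polynomial in
theorem X_pow_three_sub_one_modTwo :
    (X ^ 3 - 1 : (ZMod 2)[X]) = (X + 1) * (X ^ 2 + X + 1) := by
  have h2 : (2 : (ZMod 2)[X]) = 0 := CharTwo.two_eq_zero
  linear_combination (- X ^ 2 - X - 1) * h2

open Polynomial in
theorem isCoprime_factors : IsCoprime (X + 1 : (ZMod 2)[X]) (X ^ 2 + X + 1) :=
  ⟨-X, 1, by ring⟩

open Polynomial in
theorem monic_factor_one : (X + 1 : (ZMod 2)[X]).Monic := by monicity!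

open Polynomial in
theorem monic_factor_two : (X ^ 2 + X + 1 : (ZMod 2)[X]).Monic := by monicity!

open Polynomial in
theorem natDegree_factor_one : (X + 1 : (ZMod 2)[X]).natDegree = 1 := by compute_degree!

open Polynomial in
theorem natDegree_factor_two : (X ^ 2 + X + 1 : (ZMod 2)[X]).natDegree = 2 := by compute_degree!

/-- Divisibility between powers of a nonconstant monic polynomial, up to a coprime factor. -/
theorem le_of_pow_dvd_pow_mul {p r : Polynomial (ZMod 2)} (hp : p.Monic) (hd : 0 < p.natDegree)
    (hc : IsCoprime p r) {a x y : ℕ} (h : p ^ a ∣ p ^ x * r ^ y) : a ≤ x := by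
  have h1 : p ^ a ∣ p ^ x := (hc.pow (m := a) (n := y)).dvd_of_dvd_mul_right h
  have h2 := Polynomial.natDegree_le_of_dvd h1 (hp.pow x).ne_zero
  rw [hp.natDegree_pow, hp.natDegree_pow] at h2
  exact Nat.le_of_mul_le_mul_right h2 hd

open Polynomial in
/-- Division of products of powers of the two factors of `X ^ 3 - 1`. -/
theorem eq_of_mul_pow_eq {f : (ZMod 2)[X]} {u v x y : ℕ}
    (h : (X + 1) ^ x * (X ^ 2 + X + 1) ^ y = f * ((X + 1) ^ u * (X ^ 2 + X + 1) ^ v)) :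
    u ≤ x ∧ v ≤ y ∧ f = (X + 1) ^ (x - u) * (X ^ 2 + X + 1) ^ (y - v) := by
  have hu : u ≤ x := le_of_pow_dvd_pow_mul monic_factor_one
    (by rw [natDegree_factor_one]; norm_num) isCoprime_factors
    (h ▸ (Dvd.intro _ rfl : (X + 1 : (ZMod 2)[X]) ^ u ∣ _ * _).mul_left f)
  have hv : v ≤ y := le_of_pow_dvd_pow_mul monic_factor_two
    (by rw [natDegree_factor_two]; norm_num) isCoprime_factors.symm
    (by rw [mul_comm, h]; exact (Dvd.intro_left _ rfl : _ ∣ _ * _).mul_left f)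
  refine ⟨hu, hv, ?_⟩
  have hne : ((X + 1) ^ u * (X ^ 2 + X + 1) ^ v : (ZMod 2)[X]) ≠ 0 :=
    ((monic_factor_one.pow u).mul (monic_factor_two.pow v)).ne_zero
  apply mul_right_cancel₀ hne
  rw [← h]
  obtain ⟨a, rfl⟩ := Nat.exists_eq_add_of_le hu
  obtain ⟨b, rfl⟩ := Nat.exists_eq_add_of_le hv
  simp only [Nat.add_sub_cancel_left]
  ring

open Polynomial in
/-- The characteristic polynomial of order `2 ^ l` modulo `2`. -/
theorem charpoly_symPascalModTwo_two_pow (l : ℕ) : ∃ a b : ℕ,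
    (symPascalModTwo (2 ^ l)).charpoly = (X + 1) ^ a * (X ^ 2 + X + 1) ^ b ∧
      (3 * a : ℤ) = 2 ^ l + 2 * (-1) ^ l ∧ (3 * b : ℤ) = 2 ^ l - (-1) ^ l := by
  induction l with
  | zero =>
    refine ⟨1, 0, ?_, by norm_num, by norm_num⟩
    rw [Matrix.charpoly, pow_zero, Matrix.det_unique]
    simp [symPascalModTwo, pascalModTwo, CharTwo.sub_eq_add]
  | succ l ih =>
    obtain ⟨a, b, hab, ha, hb⟩ := ih
    have h := charpoly_symPascalModTwo_mul (l + 1) (2 ^ l) (2 ^ l) (by ring) le_rfl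
    have hne : (symPascalModTwo (2 ^ l)).charpoly ≠ 0 := (Matrix.charpoly_monic _).ne_zero
    have h' : (symPascalModTwo (2 ^ l + 2 ^ l)).charpoly * (symPascalModTwo (2 ^ l)).charpoly =
        (X ^ 3 - 1) ^ (2 ^ l) := by
      apply mul_left_cancel₀ hne
      rw [← h]; ring
    rw [X_pow_three_sub_one_modTwo, mul_pow, hab] at h'
    obtain ⟨hu, hv, hf⟩ := eq_of_mul_pow_eq h'.symm
    refine ⟨2 ^ l - a, 2 ^ l - b, ?_, ?_, ?_⟩
    · rw [← hf, pow_succ, mul_two]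
    · push_cast [Nat.cast_sub hu]
      rw [pow_succ, pow_succ]; linarith
    · push_cast [Nat.cast_sub hv]
      rw [pow_succ, pow_succ]; linarith

/-! ### The recursion for γ -/

theorem three_mul_two_pow_add_div (l : ℕ) :
    3 * (((2 : ℤ) ^ l + 2 * (-1) ^ l) / 3) = 2 ^ l + 2 * (-1) ^ l := by
  obtain ⟨a, -, -, ha, -⟩ := charpoly_symPascalModTwo_two_pow l
  omega

/-- The recursion for `pascalGamma`, away from the overlap of two consecutive ranges. -/
theorem pascalGamma_two_pow_sub_of_lt (l k : ℕ) (h : 2 * k < 2 ^ l) :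
    pascalGamma (2 ^ l - k) =
      ((2 : ℤ) ^ l + 2 * (-1) ^ l) / 3 - k + 2 * pascalGamma k := by
  obtain ⟨m, hm⟩ : ∃ m, 2 ^ l - k = m + 1 := ⟨2 ^ l - k - 1, by omega⟩
  have hl : Nat.clog 2 (m + 1) = l := by
    apply le_antisymm
    · rw [Nat.clog_le_iff_le_pow one_lt_two]; omega
    · rcases l with _ | l
      · omega
      · rw [pow_succ] at hm h
        rw [Nat.succ_le_iff, Nat.lt_clog_iff_pow_lt one_lt_two]
        omega
  rw [hm, pascalGamma, hl, ← hm, show 2 ^ l - (2 ^ l - k) = k by omega]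

theorem three_mul_pascalGamma_two_pow (l : ℕ) :
    3 * pascalGamma (2 ^ l) = (2 : ℤ) ^ l + 2 * (-1) ^ l := by
  have h := pascalGamma_two_pow_sub_of_lt l 0 (by positivity)
  have h0 : pascalGamma 0 = 0 := by rw [pascalGamma]
  rw [Nat.sub_zero, h0] at h
  have := three_mul_two_pow_add_div l
  push_cast at h
  omega

theorem three_mul_pascalGamma_two_pow_sub (l k : ℕ) (h : 2 * k ≤ 2 ^ l) :
    3 * pascalGamma (2 ^ l - k) =
      (2 : ℤ) ^ l + 2 * (-1) ^ l - 3 * k + 6 * pascalGamma k := by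
  rcases h.lt_or_eq with h | h
  · have := pascalGamma_two_pow_sub_of_lt l k h
    have := three_mul_two_pow_add_div l
    omega
  -- At the boundary 2k = 2^l the definition of `pascalGamma` uses the exponent l - 1 instead; the
  -- closed form at powers of 2 shows that the two agree.
  · rcases l with _ | l
    · omega
    · rw [pow_succ] at h
      obtain rfl : k = 2 ^ l := by omega
      have := three_mul_pascalGamma_two_pow l
      rw [show 2 ^ (l + 1) - 2 ^ l = 2 ^ l by rw [pow_succ]; omega, pow_succ, pow_succ]
      push_cast
      linarith

theorem exists_eq_two_pow_sub (n : ℕ) (hn : n ≠ 0) :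
    ∃ l k, n = 2 ^ l - k ∧ 2 * k ≤ 2 ^ l ∧ k < n := by
  obtain ⟨m, rfl⟩ := Nat.exists_eq_succ_of_ne_zero hn
  have h1 := two_pow_clog_sub_lt m
  have h2 : m + 1 ≤ 2 ^ Nat.clog 2 (m + 1) := Nat.le_pow_clog one_lt_two _
  exact ⟨Nat.clog 2 (m + 1), 2 ^ Nat.clog 2 (m + 1) - (m + 1), by omega, by omega, h1⟩

theorem isPascalGamma_pascalGamma : IsPascalGamma pascalGamma := by
  refine ⟨by rw [pascalGamma], fun l k h => ?_⟩
  have h3 : (3 * pascalGamma (2 ^ l - k) : ℚ) =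
      (2 : ℚ) ^ l + 2 * (-1) ^ l - 3 * k + 6 * pascalGamma k := by
    exact_mod_cast three_mul_pascalGamma_two_pow_sub l k h
  linarith

theorem IsPascalGamma.unique {δ ε : ℕ → ℤ} (hδ : IsPascalGamma δ) (hε : IsPascalGamma ε) :
    δ = ε := by
  funext n
  induction n using Nat.strong_induction_on with
  | _ n ih =>
    rcases eq_or_ne n 0 with rfl | hn
    · rw [hδ.1, hε.1]
    · obtain ⟨l, k, rfl, h, hk⟩ := exists_eq_two_pow_sub n hn
      have := hδ.2 l k h
      rw [ih k hk, ← hε.2 l k h] at this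
      exact_mod_cast this

/-! ### Factorization and nilpotency -/

open Polynomial in
/-- The factorization of the characteristic polynomial modulo `2`. -/
theorem charpoly_symPascalModTwo (n : ℕ) : ∃ a b : ℕ,
    (symPascalModTwo n).charpoly = (X + 1) ^ a * (X ^ 2 + X + 1) ^ b ∧
      (a : ℤ) = pascalGamma n ∧ a + 2 * b = n := by
  induction n using Nat.strong_induction_on with
  | _ n ih =>
    rcases eq_or_ne n 0 with rfl | hn
    · exact ⟨0, 0, by simp [Matrix.charpoly], by rw [pascalGamma]; rfl, rfl⟩
    · obtain ⟨l, k, hlk, h, hk⟩ := exists_eq_two_pow_sub n hn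
      obtain ⟨a, b, hab, ha, hb⟩ := ih k hk
      obtain ⟨A, B, hAB, hA, hB⟩ := charpoly_symPascalModTwo_two_pow l
      have hnk : n + k = 2 ^ l := by omega
      have hrel := charpoly_symPascalModTwo_mul l n k hnk hk.le
      rw [hnk, X_pow_three_sub_one_modTwo, hab, hAB, mul_pow] at hrel
      obtain ⟨hu, hv, hf⟩ := eq_of_mul_pow_eq (x := A + 2 * a) (y := B + 2 * b) (u := k) (v := k)
        (by rw [← mul_pow, ← hrel]; ring)
      have hg := three_mul_pascalGamma_two_pow_sub l k h
      rw [← hlk] at hg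
      have hnk' : (n + k : ℤ) = 2 ^ l := by exact_mod_cast hnk
      -- The exponents are A + 2a - k and B + 2b - k; `hu` and `hv` make these subtractions exact.
      refine ⟨_, _, hf, ?_, ?_⟩
      · push_cast [Nat.cast_sub hu]
        linarith
      · zify [hu, hv]
        have : (a : ℤ) + 2 * b = k := by exact_mod_cast hb
        linarith

-- Cayley–Hamilton, since χ_n divides a power of X³ - 1.
open Polynomial in
theorem isNilpotent_one_sub_symPascalModTwo_pow_three (n : ℕ) :
    IsNilpotent (1 - symPascalModTwo n ^ 3) := by
  obtain ⟨a, b, hab, -, -⟩ := charpoly_symPascalModTwo n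
  have hdvd : (symPascalModTwo n).charpoly ∣ (X ^ 3 - 1) ^ (a + b) := by
    rw [hab, X_pow_three_sub_one_modTwo, mul_pow]
    exact mul_dvd_mul (pow_dvd_pow _ (Nat.le_add_right a b)) (pow_dvd_pow _ (Nat.le_add_left b a))
  have h0 : aeval (symPascalModTwo n) ((X ^ 3 - 1 : (ZMod 2)[X]) ^ (a + b)) = 0 :=
    aeval_eq_zero_of_dvd_aeval_eq_zero hdvd (Matrix.aeval_self_charpoly _)
  rw [← neg_sub, isNilpotent_neg_iff]
  exact ⟨a + b, by simpa using h0⟩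

theorem theorem1p4 :
    -- `γ` is the unique sequence that satisfies its defining recursion
    (IsPascalGamma pascalGamma ∧ ∀ δ : ℕ → ℤ, IsPascalGamma δ → δ = pascalGamma) ∧
    ∀ n : ℕ,
      -- the exponents are natural numbers, and `γ₂(n)` is exactly half of `n - γ(n)`
      (0 ≤ pascalGamma n ∧ 0 ≤ pascalGammaTwo n ∧
        2 * pascalGammaTwo n = (n : ℤ) - pascalGamma n) ∧
      -- the characteristic polynomial modulo `2`
      (symPascalChi n).map (Int.castRingHom (ZMod 2)) =
        (Polynomial.X + 1) ^ (pascalGamma n).toNat *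
          (Polynomial.X ^ 2 + Polynomial.X + 1) ^ (pascalGammaTwo n).toNat ∧
      -- nilpotency over the field with two elements
      IsNilpotent (1 - (symPascal n).map (Int.castRingHom (ZMod 2)) ^ 3) := by
  refine ⟨⟨isPascalGamma_pascalGamma, fun δ hδ => hδ.unique isPascalGamma_pascalGamma⟩,
    fun n => ?_⟩
  obtain ⟨a, b, hab, ha, hb⟩ := charpoly_symPascalModTwo n
  have h2 : pascalGammaTwo n = b := by unfold pascalGammaTwo; omega
  refine ⟨⟨by omega, by omega, by omega⟩, ?_, ?_⟩
  · rw [symPascalChi, ← Matrix.charpoly_map, symPascal_map, hab, h2, ← ha, Int.toNat_natCast,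
      Int.toNat_natCast]
  · rw [symPascal_map]
    exact isNilpotent_one_sub_symPascalModTwo_pow_three n
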